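/- Let $(W,S)$ be a Coxeter system of rank $n\ge 1$ with $S=\{s_1,\dots,s_n\}$ and labels $m(s_i,s_j)\in\{2,3,\dots\}\cup\{\infty\}$ for $i\neq j$, so that $W=\langle S\mid s_i^2=1,\ (s_is_j)^{m(s_i,s_j)}=1 \text{ whenever } i\ne j \text{ and } m(s_i,s_j)<\infty\rangle$. Let $l_R$ be the reflection length on $W$: $l_R(v)$ is the least $k$ such that $v$ is a product of $k$ conjugates of elements of $S$. Let $W_n$ be the universal Coxeter group on $s_1,\dots,s_n$ (all $m(s_i,s_j)=\infty$ for $i\neq j$) and $l_{R_n}$ its reflection length. For a word $\mathbf a$ over $S$, write $\omega(\mathbf a)\in W$ and $\omega_n(\mathbf a)\in W_n$ for the elements that it represents. Put $\mathbf w=s_1\cdots s_n$, and let $\lambda\ge 0$ and $1\le r\le n$ be integers such that $$\lambda+\mathbb 1_{r\ge 2}<\min\{m(s_i,s_j)\mid i\ne j\},$$ where $\mathbb 1_{r\ge2}$ is $1$ if $r\ge 2$ and $0$ otherwise, and the minimum is $\infty$ if $n=1$. Then $$l_R(\omega(\mathbf w^\lambda s_1\cdots s_r))=l_{R_n}(\omega_n(\mathbf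 w^\lambda s_1\cdots s_r)),$$ and, if $n\ge 2$, this common value is $\lambda(n-2)+r$. -/

import Mathlib

namespace CoxeterMatrix

/-- The label `m(s_i, s_j)` as an element of `ℕ ∪ {∞}`. (A matrix entry `0` encodes the label `∞`.) -/
def label {B : Type*} (M : CoxeterMatrix B) (i j : B) : ℕ∞ :=
  if M i j = 0 then ⊤ else (M i j : ℕ∞)

/-- The minimum of the labels `m(s_i, s_j)` over all pairs of distinct generators
(it is `∞` if there are no such pairs). -/
noncomputable def minLabel {B : Type*} (M : CoxeterMatrix B) : ℕ∞ :=
  ⨅ (i : B) (j : B) (_ : i ≠ j), M.label i j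

/-- The Coxeter matrix of the universal Coxeter group of rank `n`: every label of a pair of
distinct generators is `∞`, encoded as `0`. -/
def universal (n : ℕ) : CoxeterMatrix (Fin n) where
  M := Matrix.of fun i j => if i = j then 1 else 0
  isSymm := by
    ext i j
    simp [Matrix.transpose_apply, eq_comm]
  diagonal := by simp
  off_diagonal := by
    intro i j h
    simp [h]

end CoxeterMatrix

namespace CoxeterSystem

/-- The reflection length of `w`: the least number of reflections (conjugates of simple
reflections) whose product is `w`. Reflections are involutions, so no inverses are needed. -/
noncomputable def reflectionLength {B W : Type*} [Group W] {M : CoxeterMatrix B}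
    (cs : CoxeterSystem M W) (w : W) : ℕ :=
  sInf {k : ℕ | ∃ l : List W, l.length = k ∧ (∀ t ∈ l, cs.IsReflection t) ∧ l.prod = w}

/-- The reflection length is attained by some factorisation into reflections. -/
theorem exists_reflection_factorisation {B W : Type*} [Group W] {M : CoxeterMatrix B}
    (cs : CoxeterSystem M W) (w : W) :
    ∃ l : List W, l.length = cs.reflectionLength w ∧ (∀ t ∈ l, cs.IsReflection t) ∧
      l.prod = w := by
  refine Nat.sInf_mem
    (s := {k : ℕ | ∃ l : List W, l.length = k ∧ (∀ t ∈ l, cs.IsReflection t) ∧ l.prod = w}) ?_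
  obtain ⟨ω, rfl⟩ := cs.wordProd_surjective w
  refine ⟨_, ω.map cs.simple, rfl, ?_, rfl⟩
  intro t ht
  obtain ⟨i, -, rfl⟩ := List.mem_map.1 ht
  exact cs.isReflection_simple i

end CoxeterSystem

/-- The word `(s_1 ⋯ s_n)^lam · s_1 ⋯ s_r` over the alphabet `{s_1, …, s_n}` (for `r ≤ n`),
where the letter `s_{i+1}` is `i : Fin n`. -/
def coxeterPowerWord (n lam r : ℕ) : List (Fin n) :=
  (List.replicate lam (List.finRange n)).flatten ++ (List.finRange n).take r

/-! Upper bound: write `w = aT` with first letter `a`. For `λ ≥ 1`, conjugating `w ^ λ a` by `a`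
cancels two letters and leaves `T (aT) ^ (λ - 1) = (Ta) ^ (λ - 1) T`, a word of the same shape for
the rotated word `Ta`. The remaining `r - 1` letters cost at most one reflection each, so by
induction each factor `w` costs `n - 2`.

Lower bound: by one half of Dyer's theorem (`trivialAfterDeleting_of_prod_reflections`), every word
for a product of `k` reflections becomes trivial after deleting at most `k` letters. So it suffices
to bound the length of a trivial subword. The measure is the number `d` of weak descents, which does
not grow under deletion. If all labels are at least `d + 2`, a nonempty word without equal adjacent
letters is nontrivial (`wordProd_ne_one_of_isChain`), and cancelling an equal adjacent pair removes
two letters and at least one weak descent. Hence a trivial word has at most `2d` letters. The word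
in question has `λn + r` letters and at most `λ` weak descents, so at least `λ(n - 2) + r` letters
must be deleted. Only a lower bound on the labels enters, so the universal group gives the same
value.

Nontriviality comes from cutting the word at a middle weak descent. Two distinct left descents of an
element force a long alternating prefix in some reduced word, and such a prefix has many weak
descents. A half with few of them is therefore reduced, and the other half is even the only reduced
word of its element, so the halves cannot be mutually inverse. -/

namespace CoxeterSystem

variable {B W : Type*} [Group W] {M : CoxeterMatrix B} (cs : CoxeterSystem M W)

/-! ### The parity of the number of occurrences of a reflection in an inversion sequence -/

open Classical in
/-- The action of a simple reflection on `W × ZMod 2`: conjugation on the first component, and a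
flip of the sign at the simple reflection itself. -/
noncomputable def signedConj (i : B) : Function.End (W × ZMod 2) := fun p =>
  (cs.simple i * p.1 * cs.simple i, p.2 + if p.1 = cs.simple i then 1 else 0)

theorem inv_mul_simple_pow_mul_simple (i j : B) (p : ℕ) :
    ((cs.simple i * cs.simple j) ^ p)⁻¹ * cs.simple j =
      cs.simple j * (cs.simple i * cs.simple j) ^ p := by
  induction p with
  | zero => simp
  | succ p ih =>
    rw [pow_succ, mul_inv_rev, mul_assoc, ih, ← mul_assoc, ← mul_assoc, mul_assoc _ _ (_ ^ p),
      mul_assoc _ (_ ^ p), ← pow_succ, pow_succ']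
    simp [mul_assoc]

theorem conj_pow_eq_simple_mul_pow_iff (i j : B) (p e : ℕ) (t : W) :
    (cs.simple i * cs.simple j) ^ p * t * ((cs.simple i * cs.simple j) ^ p)⁻¹ =
        cs.simple j * (cs.simple i * cs.simple j) ^ e ↔
      t = cs.simple j * (cs.simple i * cs.simple j) ^ (2 * p + e) := by
  rw [mul_inv_eq_iff_eq_mul, ← eq_inv_mul_iff_mul_eq, ← mul_assoc, ← mul_assoc,
    inv_mul_simple_pow_mul_simple, mul_assoc, mul_assoc, ← pow_add, ← pow_add]
  congr! 3
  ring

-- Each of the `2k` simple factors flips the sign at one reflection. Pulled back to the original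
-- `t`, these are the `s_j (s_i s_j) ^ q` with `q < 2k`.
open Classical in
theorem signedConj_mul_pow_apply (i j : B) (k : ℕ) (t : W) (ε : ZMod 2) :
    ((cs.signedConj i * cs.signedConj j) ^ k : Function.End (W × ZMod 2)) (t, ε) =
      ((cs.simple i * cs.simple j) ^ k * t * ((cs.simple i * cs.simple j) ^ k)⁻¹,
        ε + ∑ q ∈ Finset.range (2 * k),
          if t = cs.simple j * (cs.simple i * cs.simple j) ^ q then 1 else 0) := by
  induction k with
  | zero => simp; rfl
  | succ k ih =>
    rw [pow_succ']
    change cs.signedConj i (cs.signedConj j (((cs.signedConj i * cs.signedConj j) ^ k :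
      Function.End (W × ZMod 2)) (t, ε))) = _
    rw [ih]
    have h0 := cs.conj_pow_eq_simple_mul_pow_iff i j k 0 t
    have h1 := cs.conj_pow_eq_simple_mul_pow_iff i j k 1 t
    rw [pow_zero, mul_one, add_zero] at h0
    have h2 : ∀ x : W, cs.simple j * x * cs.simple j = cs.simple i ↔
        x = cs.simple j * (cs.simple i * cs.simple j) ^ 1 := by
      intro x
      constructor
      · intro h
        simp [← h, mul_assoc]
      · rintro rfl
        simp [mul_assoc]
    simp only [signedConj, h0, h2, h1]
    refine Prod.ext ?_ ?_
    · simp [pow_succ', mul_assoc]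
    · simp only [mul_add, mul_one, Finset.sum_range_succ, add_assoc]

/-- For `k = M i j` the list of flips runs twice through the same `M i j` reflections, so the signs
cancel modulo 2. -/
theorem isLiftable_signedConj : M.IsLiftable cs.signedConj := by
  classical
  intro i j
  funext ⟨t, ε⟩
  rw [signedConj_mul_pow_apply, simple_mul_simple_pow, two_mul, Finset.sum_range_add]
  simp only [pow_add, simple_mul_simple_pow, one_mul, CharTwo.add_self_eq_zero]
  simp
  rfl

/-- The parity of the number of occurrences of `t` in the right inversion sequence of a word
for `w`. -/
noncomputable def invParity (w t : W) : ZMod 2 :=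
  (cs.lift ⟨cs.signedConj, cs.isLiftable_signedConj⟩ w (t, 0)).2

open Classical in
theorem lift_signedConj_wordProd (ω : List B) (t : W) (ε : ZMod 2) :
    cs.lift ⟨cs.signedConj, cs.isLiftable_signedConj⟩ (cs.wordProd ω) (t, ε) =
      (cs.wordProd ω * t * (cs.wordProd ω)⁻¹, ε + ((cs.rightInvSeq ω).count t : ZMod 2)) := by
  induction ω with
  | nil => simp; rfl
  | cons i ω ih =>
    rw [wordProd_cons, map_mul]
    change cs.lift ⟨cs.signedConj, cs.isLiftable_signedConj⟩ (cs.simple i)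
      (cs.lift ⟨cs.signedConj, cs.isLiftable_signedConj⟩ (cs.wordProd ω) (t, ε)) = _
    rw [ih, lift_apply_simple]
    refine Prod.ext ?_ ?_
    · simp [signedConj, mul_assoc]
    · have h : cs.wordProd ω * t * (cs.wordProd ω)⁻¹ = cs.simple i ↔
          (cs.wordProd ω)⁻¹ * cs.simple i * cs.wordProd ω = t := by
        rw [mul_inv_eq_iff_eq_mul, ← eq_inv_mul_iff_mul_eq, mul_assoc, eq_comm]
      simp only [signedConj, rightInvSeq, List.count_cons, h, beq_iff_eq]
      push_cast
      ring

open Classical in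
theorem invParity_wordProd (ω : List B) (t : W) :
    cs.invParity (cs.wordProd ω) t = ((cs.rightInvSeq ω).count t : ZMod 2) := by
  simp [invParity, lift_signedConj_wordProd]

/-- The cocycle rule, read off from the composition of two actions. It makes the parity computable
without choosing words. -/
theorem invParity_mul (w w' t : W) :
    cs.invParity (w * w') t = cs.invParity w' t + cs.invParity w (w' * t * w'⁻¹) := by
  classical
  obtain ⟨ω, rfl⟩ := cs.wordProd_surjective w
  obtain ⟨ω', rfl⟩ := cs.wordProd_surjective w'
  rw [invParity_wordProd, invParity_wordProd, invParity, map_mul]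
  change (cs.lift ⟨cs.signedConj, cs.isLiftable_signedConj⟩ (cs.wordProd ω)
    (cs.lift ⟨cs.signedConj, cs.isLiftable_signedConj⟩ (cs.wordProd ω') (t, 0))).2 = _
  rw [lift_signedConj_wordProd, lift_signedConj_wordProd, zero_add]

@[simp]
theorem invParity_one (t : W) : cs.invParity 1 t = 0 := by
  rw [← cs.wordProd_nil, invParity_wordProd]
  simp

@[simp]
theorem invParity_simple_self (i : B) : cs.invParity (cs.simple i) (cs.simple i) = 1 := by
  rw [← cs.wordProd_singleton, invParity_wordProd]
  simp

theorem invParity_inv_conj (w t : W) : cs.invParity w⁻¹ (w * t * w⁻¹) = cs.invParity w t := by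
  have h := cs.invParity_mul w⁻¹ w t
  rw [inv_mul_cancel, invParity_one] at h
  exact (CharTwo.add_eq_zero.1 h.symm).symm

/-- For `t = w s w⁻¹` the contributions of `w` and `w⁻¹` agree and cancel modulo 2, leaving that of
`s` at itself. -/
theorem invParity_self {t : W} (ht : cs.IsReflection t) : cs.invParity t t = 1 := by
  obtain ⟨w, i, rfl⟩ := ht
  rw [invParity_mul, invParity_inv_conj, invParity_mul]
  have : w⁻¹ * (w * cs.simple i * w⁻¹) * w⁻¹⁻¹ = cs.simple i := by group
  rw [this, mul_inv_cancel_right, invParity_simple_self, add_left_comm, CharTwo.add_self_eq_zero,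
    add_zero]

theorem invParity_mul_self (w : W) {t : W} (ht : cs.IsReflection t) :
    cs.invParity (w * t) t = 1 + cs.invParity w t := by
  rw [invParity_mul, cs.invParity_self ht, mul_inv_cancel_right]

theorem mem_rightInvSeq_of_invParity {ω : List B} {t : W}
    (h : cs.invParity (cs.wordProd ω) t = 1) : t ∈ cs.rightInvSeq ω := by
  classical
  rw [invParity_wordProd] at h
  by_contra hn
  rw [List.count_eq_zero_of_not_mem hn] at h
  simp at h

/-- Odd parity forces `t` into the inversion sequence of every word for the element, and multiplying
by an entry of that sequence deletes a letter. The word need not be reduced. -/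
theorem exists_eraseIdx_of_invParity {ω : List B} {t : W}
    (h : cs.invParity (cs.wordProd ω) t = 1) :
    ∃ j < ω.length, cs.wordProd (ω.eraseIdx j) = cs.wordProd ω * t := by
  obtain ⟨j, hj, rfl⟩ := List.mem_iff_getElem.1 (cs.mem_rightInvSeq_of_invParity h)
  refine ⟨j, by simpa using hj, ?_⟩
  rw [← List.getD_eq_getElem _ 1 hj, wordProd_mul_getD_rightInvSeq]

theorem length_mul_lt_of_invParity {w t : W} (h : cs.invParity w t = 1) :
    cs.length (w * t) < cs.length w := by
  obtain ⟨ω, hω, rfl⟩ := cs.exists_isReduced w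
  exact (cs.isRightInversion_of_mem_rightInvSeq hω (cs.mem_rightInvSeq_of_invParity h)).2

/-- Otherwise the parity of `t` at `w * t` is 1, which makes `w = (w * t) * t` shorter than `w * t`.
-/
theorem invParity_eq_one_of_length_mul_lt {w t : W} (ht : cs.IsReflection t)
    (h : cs.length (w * t) < cs.length w) : cs.invParity w t = 1 := by
  by_contra hn
  have h0 : cs.invParity w t = 0 := by
    generalize cs.invParity w t = x at hn
    revert x; decide
  have h1 := cs.length_mul_lt_of_invParity
    (by rw [cs.invParity_mul_self w ht, h0, add_zero] : cs.invParity (w * t) t = 1)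
  rw [mul_assoc, ht.mul_self, mul_one] at h1
  exact lt_asymm h h1

/-- **Strong exchange condition**, for arbitrary words. -/
theorem exists_eraseIdx_of_length_mul_lt {ω : List B} {t : W} (ht : cs.IsReflection t)
    (h : cs.length (cs.wordProd ω * t) < cs.length (cs.wordProd ω)) :
    ∃ j < ω.length, cs.wordProd (ω.eraseIdx j) = cs.wordProd ω * t :=
  cs.exists_eraseIdx_of_invParity (cs.invParity_eq_one_of_length_mul_lt ht h)

/-- The exchange condition on the left. -/
theorem exists_eraseIdx_of_isLeftDescent {ω : List B} {i : B}
    (h : cs.IsLeftDescent (cs.wordProd ω) i) :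
    ∃ j < ω.length, cs.wordProd (ω.eraseIdx j) = cs.simple i * cs.wordProd ω := by
  have ht : cs.IsReflection ((cs.wordProd ω)⁻¹ * cs.simple i * cs.wordProd ω) := by
    simpa using (cs.isReflection_simple i).conj (cs.wordProd ω)⁻¹
  have e : cs.wordProd ω * ((cs.wordProd ω)⁻¹ * cs.simple i * cs.wordProd ω) =
      cs.simple i * cs.wordProd ω := by group
  have := cs.exists_eraseIdx_of_length_mul_lt (ω := ω) ht (by rw [e]; exact h)
  rwa [e] at this

/-- Entries occurring exactly once have odd parity, hence occur in the inversion sequence of any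
reduced word for the same element, which is then at least as long. -/
theorem isReduced_of_nodup_rightInvSeq {ω : List B} (h : (cs.rightInvSeq ω).Nodup) :
    cs.IsReduced ω := by
  classical
  obtain ⟨ω', hω', e⟩ := cs.exists_isReduced (cs.wordProd ω)
  have hsub : cs.rightInvSeq ω ⊆ cs.rightInvSeq ω' := by
    intro t ht
    apply cs.mem_rightInvSeq_of_invParity
    rw [← e, invParity_wordProd, List.count_eq_one_of_mem h ht, Nat.cast_one]
  have := (h.subperm hsub).length_le
  simp only [length_rightInvSeq] at this
  refine le_antisymm (cs.length_wordProd_le ω) ?_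
  rw [e, hω'.eq]
  exact this

theorem isReduced_of_nodup_leftInvSeq {ω : List B} (h : (cs.leftInvSeq ω).Nodup) :
    cs.IsReduced ω := by
  rw [← cs.isReduced_reverse_iff]
  apply cs.isReduced_of_nodup_rightInvSeq
  rwa [rightInvSeq_reverse, List.nodup_reverse]

/-! ### Reflection length and deletion of letters -/

/-- At most `k` letters can be deleted from the word `u` so that the rest represents `1`. -/
def TrivialAfterDeleting (k : ℕ) (u : List B) : Prop :=
  ∃ v, v.Sublist u ∧ cs.wordProd v = 1 ∧ u.length ≤ v.length + k

/-- The elements represented by words in the two letters `i` and `j`. -/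
def dihedral (i j : B) : Subgroup W where
  carrier := {g | ∃ l : List B, (∀ c ∈ l, c = i ∨ c = j) ∧ cs.wordProd l = g}
  mul_mem' := by
    rintro _ _ ⟨l, hl, rfl⟩ ⟨l', hl', rfl⟩
    refine ⟨l ++ l', ?_, cs.wordProd_append _ _⟩
    simp only [List.mem_append]
    rintro c (hc | hc)
    exacts [hl c hc, hl' c hc]
  one_mem' := ⟨[], by simp, by simp⟩
  inv_mem' := by
    rintro _ ⟨l, hl, rfl⟩
    exact ⟨l.reverse, by simpa using hl, cs.wordProd_reverse l⟩

theorem lengthParity_wordProd (l : List B) :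
    cs.lengthParity (cs.wordProd l) = Multiplicative.ofAdd (l.length : ZMod 2) := by
  induction l with
  | nil => simp
  | cons i l ih => simp [wordProd_cons, ih, lengthParity_simple, ← ofAdd_add, add_comm]

theorem odd_length_wordProd_iff (l : List B) :
    Odd (cs.length (cs.wordProd l)) ↔ Odd l.length := by
  have h := (cs.lengthParity_wordProd l).symm.trans (cs.lengthParity_eq_ofAdd_length _)
  rw [Multiplicative.ofAdd.injective.eq_iff] at h
  rw [← ZMod.natCast_eq_one_iff_odd, ← ZMod.natCast_eq_one_iff_odd, h]

theorem odd_length_mul_simple_iff (w : W) (i : B) :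
    Odd (cs.length (w * cs.simple i)) ↔ Even (cs.length w) := by
  have := cs.length_mul_simple w i
  grind

theorem odd_length_conj_iff (w g : W) :
    Odd (cs.length (w * g * w⁻¹)) ↔ Odd (cs.length g) := by
  have h1 := cs.length_mul_mod_two (w * g) w⁻¹
  have h2 := cs.length_mul_mod_two w g
  rw [length_inv] at h1
  grind

theorem exists_wordProd_eq_zpow {i j : B} (l : List B) (hl : ∀ c ∈ l, c = i ∨ c = j) :
    ∃ z : ℤ, cs.wordProd l =
      if Even l.length then (cs.simple i * cs.simple j) ^ z
      else cs.simple i * (cs.simple i * cs.simple j) ^ z := by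
  have hj : cs.simple j = cs.simple i * (cs.simple i * cs.simple j) := by simp
  have hji : cs.simple j * cs.simple i = (cs.simple i * cs.simple j)⁻¹ := by simp
  induction l with
  | nil => exact ⟨0, by simp⟩
  | cons c l ih =>
    obtain ⟨z, hz⟩ := ih fun c hc => hl c (by simp [hc])
    simp only [wordProd_cons, hz, List.length_cons, Nat.even_add_one]
    by_cases he : Even l.length
    · simp only [he, if_true, not_true, if_false]
      rcases hl c (by simp) with rfl | rfl
      · exact ⟨z, rfl⟩
      · refine ⟨1 + z, ?_⟩
        rw [zpow_add, zpow_one, ← mul_assoc, ← hj]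
    · simp only [he, if_false, not_false_iff, if_true]
      rcases hl c (by simp) with rfl | rfl
      · exact ⟨z, by simp⟩
      · refine ⟨-1 + z, ?_⟩
        rw [zpow_add, zpow_neg_one, ← mul_assoc, ← hji]

/-- A word of odd length in two letters represents a reflection. -/
theorem isReflection_wordProd_of_odd {i j : B} (l : List B) (hl : ∀ c ∈ l, c = i ∨ c = j)
    (hodd : Odd l.length) : cs.IsReflection (cs.wordProd l) := by
  obtain ⟨z, hz⟩ := cs.exists_wordProd_eq_zpow l hl
  rw [if_neg (Nat.not_even_iff_odd.2 hodd)] at hz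
  have hcomm : ∀ a : ℤ, cs.simple i * (cs.simple i * cs.simple j) ^ a =
      (cs.simple i * cs.simple j) ^ (-a) * cs.simple i := by
    intro a
    have h : (cs.simple i * (cs.simple i * cs.simple j) * (cs.simple i)⁻¹) ^ a =
        cs.simple i * (cs.simple i * cs.simple j) ^ a * (cs.simple i)⁻¹ := conj_zpow
    rw [eq_mul_inv_iff_mul_eq] at h
    rw [← h, zpow_neg, ← inv_zpow]
    simp
  -- The element `s_i (s_i s_j) ^ z` is the conjugate by `(s_i s_j) ^ (-a)` of `s_i` if `z = 2a`,
  -- and of `s_j` if `z = 2a + 1`.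
  rcases Int.even_or_odd' z with ⟨a, rfl | rfl⟩
  · have : cs.wordProd l = (cs.simple i * cs.simple j) ^ (-a) * cs.simple i *
        ((cs.simple i * cs.simple j) ^ (-a))⁻¹ := by
      rw [hz, two_mul, zpow_add, ← mul_assoc, hcomm, zpow_neg, inv_inv]
    rw [this, isReflection_conj_iff]
    exact cs.isReflection_simple i
  · have : cs.wordProd l = (cs.simple i * cs.simple j) ^ (-a) * cs.simple j *
        ((cs.simple i * cs.simple j) ^ (-a))⁻¹ := by
      rw [hz, show 2 * a + 1 = a + 1 + a by ring, zpow_add, zpow_add, zpow_one, ← mul_assoc,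
        ← mul_assoc, hcomm, zpow_neg, inv_inv]
      simp [mul_assoc]
    rw [this, isReflection_conj_iff]
    exact cs.isReflection_simple j

theorem isReflection_of_mem_dihedral {i j : B} {g : W} (hg : g ∈ cs.dihedral i j)
    (hodd : Odd (cs.length g)) : cs.IsReflection g := by
  obtain ⟨l, hl, rfl⟩ := hg
  exact cs.isReflection_wordProd_of_odd l hl ((cs.odd_length_wordProd_iff l).1 hodd)

theorem trivialAfterDeleting_one_of_isReflection {u : List B}
    (h : cs.IsReflection (cs.wordProd u)) : cs.TrivialAfterDeleting 1 u := by
  obtain ⟨j, hj, e⟩ := cs.exists_eraseIdx_of_invParity (cs.invParity_self h)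
  refine ⟨u.eraseIdx j, List.eraseIdx_sublist _ _, e.trans h.mul_self, ?_⟩
  rw [List.length_eraseIdx_add_one hj]

/-- A nontrivial element of a standard dihedral subgroup has a simple right inversion. -/
theorem exists_invParity_simple_of_mem_dihedral {i j : B} {g : W} (hg : g ∈ cs.dihedral i j)
    (hne : g ≠ 1) : ∃ c, (c = i ∨ c = j) ∧ cs.invParity g (cs.simple c) = 1 := by
  classical
  have hex : ∃ N, ∃ l : List B, l.length = N ∧ (∀ c ∈ l, c = i ∨ c = j) ∧ cs.wordProd l = g := by
    obtain ⟨l, h⟩ := hg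
    exact ⟨_, l, rfl, h⟩
  obtain ⟨l, hlen, hl, rfl⟩ := Nat.find_spec hex
  have hmin := fun N => Nat.find_min hex (m := N)
  rw [← hlen] at hmin
  rcases List.eq_nil_or_concat' l with rfl | ⟨l', c, rfl⟩
  · simp at hne
  refine ⟨c, hl c (by simp), ?_⟩
  rw [wordProd_append, wordProd_singleton, invParity_mul_self _ _ (cs.isReflection_simple c)]
  -- If the last letter were not an inversion of the whole word, it would be one of the word before
  -- it, and the exchange would give a shorter word in the same two letters.
  by_contra hn
  have h1 : cs.invParity (cs.wordProd l') (cs.simple c) = 1 := by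
    generalize cs.invParity (cs.wordProd l') (cs.simple c) = x at hn
    revert x; decide
  obtain ⟨p, hp, e⟩ := cs.exists_eraseIdx_of_invParity h1
  refine hmin (l'.eraseIdx p).length ?_ ⟨l'.eraseIdx p, rfl, ?_, ?_⟩
  · have := List.length_eraseIdx_add_one hp
    simp
    omega
  · intro d hd
    exact hl d (by simp [(List.eraseIdx_sublist l' p).subset hd])
  · rw [e, wordProd_append, wordProd_singleton]

/-- Two deletions suffice for a word representing a conjugate of an even element of a standard
dihedral subgroup. -/
theorem trivialAfterDeleting_two {i j : B} {u : List B} {x g : W} (hg : g ∈ cs.dihedral i j)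
    (heven : Even (cs.length g)) (hu : cs.wordProd u = x * g * x⁻¹) :
    cs.TrivialAfterDeleting 2 u := by
  -- Replacing `x` by a shortest element of its coset changes `g` only by conjugation inside the
  -- dihedral subgroup, and leaves the new conjugator without inversions there.
  obtain ⟨p, hp, hmin⟩ : ∃ p ∈ cs.dihedral i j, ∀ q ∈ cs.dihedral i j,
      cs.length (x * p) ≤ cs.length (x * q) := by
    obtain ⟨p, hp, h⟩ := (measure fun p => cs.length (x * p)).wf.has_min
      {p | p ∈ cs.dihedral i j} ⟨1, one_mem (cs.dihedral i j)⟩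
    exact ⟨p, hp, fun q hq => not_lt.1 (h q hq)⟩
  set y := x * p with hy
  set g' := p⁻¹ * g * p with hg'
  have hu' : cs.wordProd u = y * g' * y⁻¹ := by rw [hu, hy, hg']; group
  have hg'mem : g' ∈ cs.dihedral i j := mul_mem (mul_mem (inv_mem hp) hg) hp
  have heven' : Even (cs.length g') := by
    have := cs.odd_length_conj_iff p⁻¹ g
    rw [inv_inv] at this
    rw [← Nat.not_odd_iff_even, this, Nat.not_odd_iff_even]
    exact heven
  have hzero : ∀ r ∈ cs.dihedral i j, cs.invParity y r = 0 := by
    intro r hr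
    by_contra hn
    have h1 : cs.invParity y r = 1 := by
      generalize cs.invParity y r = z at hn
      revert z; decide
    have := cs.length_mul_lt_of_invParity h1
    rw [hy, mul_assoc] at this
    exact (hmin _ (mul_mem hp hr)).not_gt this
  by_cases h1 : g' = 1
  · exact ⟨u, List.Sublist.refl u, by rw [hu', h1]; simp, by omega⟩
  obtain ⟨c, hc, hpar⟩ := cs.exists_invParity_simple_of_mem_dihedral hg'mem h1
  have hcmem : cs.simple c ∈ cs.dihedral i j := ⟨[c], by simpa using hc, by simp⟩
  -- In the cocycle expansion of `y * g' * y⁻¹` both contributions of `y` vanish, so only the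
  -- inversion of `g'` at `s_c` is left. Deleting the corresponding letter turns `g'` into the odd
  -- element `g' * s_c`, a reflection.
  have hτ : cs.invParity (cs.wordProd u) (y * cs.simple c * y⁻¹) = 1 := by
    rw [hu', invParity_mul, invParity_inv_conj, hzero _ hcmem, zero_add, invParity_mul,
      hzero _ (by simpa [mul_assoc] using mul_mem (mul_mem hg'mem hcmem) (inv_mem hg'mem)), add_zero]
    convert hpar using 2
    group
  obtain ⟨k, hk, e⟩ := cs.exists_eraseIdx_of_invParity hτ
  have e' : cs.wordProd (u.eraseIdx k) = y * (g' * cs.simple c) * y⁻¹ := by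
    rw [e, hu']; group
  have hrefl : cs.IsReflection (cs.wordProd (u.eraseIdx k)) := by
    rw [e', isReflection_conj_iff]
    exact cs.isReflection_of_mem_dihedral (mul_mem hg'mem hcmem)
      ((cs.odd_length_mul_simple_iff g' c).2 heven')
  obtain ⟨v, hv, hv1, hlen⟩ := cs.trivialAfterDeleting_one_of_isReflection hrefl
  refine ⟨v, hv.trans (List.eraseIdx_sublist _ _), hv1, ?_⟩
  have := List.length_eraseIdx_add_one hk
  omega

/-- Inserting a dihedral relator does not change the number of deletions that are needed. -/
theorem trivialAfterDeleting_insert_iff {i j : B} {R : List B} (hR : ∀ c ∈ R, c = i ∨ c = j)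
    (hR1 : cs.wordProd R = 1) (heven : Even R.length) (a b : List B) (k : ℕ) :
    cs.TrivialAfterDeleting k (a ++ R ++ b) ↔ cs.TrivialAfterDeleting k (a ++ b) := by
  constructor
  · rintro ⟨v, hv, hv1, hlen⟩
    obtain ⟨v', vb, rfl, hv', hvb⟩ := List.sublist_append_iff.1 hv
    obtain ⟨va, R', rfl, hva, hR'⟩ := List.sublist_append_iff.1 hv'
    simp only [List.length_append, wordProd_append] at hlen hv1
    have hsub : (va ++ vb).Sublist (a ++ b) := hva.append hvb
    have hRlen := hR'.length_le
    have hmem : (cs.wordProd R')⁻¹ ∈ cs.dihedral i j :=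
      inv_mem ⟨R', fun c hc => hR c (hR'.subset hc), rfl⟩
    have hconj : cs.wordProd (va ++ vb) =
        cs.wordProd va * (cs.wordProd R')⁻¹ * (cs.wordProd va)⁻¹ := by
      rw [wordProd_append, eq_inv_of_mul_eq_one_right hv1]
      group
    have key : ∀ d, cs.TrivialAfterDeleting d (va ++ vb) → R'.length + d ≤ R.length →
        cs.TrivialAfterDeleting k (a ++ b) := by
      rintro d ⟨v, hv, hv1, hlen'⟩ hd
      refine ⟨v, hv.trans hsub, hv1, ?_⟩
      simp only [List.length_append] at hlen' ⊢
      omega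
    have hpar := cs.odd_length_wordProd_iff R'
    -- The letters of `R` missing from `R'` pay for the further deletions: since `R` has even
    -- length, an odd `R'` misses at least one letter and a proper even `R'` at least two.
    rcases Nat.even_or_odd R'.length with he | ho
    · rcases hRlen.eq_or_lt with heq | hlt
      · refine key 0 ⟨_, List.Sublist.refl _, ?_, le_rfl⟩ (by omega)
        rw [hconj, hR'.eq_of_length heq, hR1]
        simp
      · refine key 2 (cs.trivialAfterDeleting_two hmem ?_ hconj) (by grind)
        rw [length_inv, ← Nat.not_odd_iff_even, hpar, Nat.not_odd_iff_even]
        exact he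
    · refine key 1 (cs.trivialAfterDeleting_one_of_isReflection ?_) (by grind)
      rw [hconj, isReflection_conj_iff]
      exact cs.isReflection_of_mem_dihedral hmem (by rw [length_inv]; exact hpar.2 ho)
  · rintro ⟨v, hv, hv1, hlen⟩
    obtain ⟨va, vb, rfl, hva, hvb⟩ := List.sublist_append_iff.1 hv
    refine ⟨va ++ R ++ vb, (hva.append (List.Sublist.refl R)).append hvb, ?_, ?_⟩
    · simpa [wordProd_append, hR1] using hv1
    · simp only [List.length_append] at hlen ⊢
      omega

/-- The congruence identifying words that can be exchanged in any word without changing the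
number of deletions that are needed. -/
def deletionCon : Con (FreeMonoid B) where
  r u v := ∀ (a b : List B) (k : ℕ), cs.TrivialAfterDeleting k (a ++ u.toList ++ b) ↔
    cs.TrivialAfterDeleting k (a ++ v.toList ++ b)
  iseqv :=
    { refl := fun _ _ _ _ => Iff.rfl
      symm := fun h a b k => (h a b k).symm
      trans := fun h h' a b k => (h a b k).trans (h' a b k) }
  mul' := by
    intro u u' v v' h h' a b k
    have h1 := h a (v.toList ++ b) k
    have h2 := h' (a ++ u'.toList) b k
    simp only [FreeMonoid.toList_mul, List.append_assoc] at h1 h2 ⊢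
    exact h1.trans h2

theorem isLiftable_deletionCon :
    M.IsLiftable fun i => (FreeMonoid.of i : cs.deletionCon.Quotient) := by
  intro i j
  refine ((cs.deletionCon.mk'.map_pow (FreeMonoid.of i * FreeMonoid.of j) (M i j)).symm.trans
    ((Con.eq _).2 ?_ : _ = ((1 : FreeMonoid B) : cs.deletionCon.Quotient)))
  intro a b k
  have h : ∀ m : ℕ, (∀ c ∈ ((FreeMonoid.of i * FreeMonoid.of j) ^ m).toList, c = i ∨ c = j) ∧
      cs.wordProd ((FreeMonoid.of i * FreeMonoid.of j) ^ m).toList =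
        (cs.simple i * cs.simple j) ^ m ∧
      Even ((FreeMonoid.of i * FreeMonoid.of j) ^ m).toList.length := by
    intro m
    induction m with
    | zero => simp
    | succ m ih =>
      obtain ⟨h1, h2, h3⟩ := ih
      rw [pow_succ', FreeMonoid.toList_mul, FreeMonoid.toList_mul]
      refine ⟨?_, ?_, ?_⟩
      · simp only [FreeMonoid.toList_of, List.mem_append, List.mem_singleton]
        rintro c ((hc | hc) | hc)
        exacts [Or.inl hc, Or.inr hc, h1 c hc]
      · simp [wordProd_cons, h2, pow_succ', mul_assoc]
      · simpa [Nat.even_add_one] using h3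
  obtain ⟨h1, h2, h3⟩ := h (M i j)
  rw [simple_mul_simple_pow] at h2
  simpa using cs.trivialAfterDeleting_insert_iff h1 h2 h3 a b k

/-- The Coxeter relators are trivial in the quotient by `deletionCon`, so the quotient map factors
through `W`: words for the same element are congruent. -/
theorem trivialAfterDeleting_congr {u v : List B} (h : cs.wordProd u = cs.wordProd v) (k : ℕ) :
    cs.TrivialAfterDeleting k u ↔ cs.TrivialAfterDeleting k v := by
  have hl : ∀ u : List B, cs.lift ⟨_, cs.isLiftable_deletionCon⟩ (cs.wordProd u) =
      (FreeMonoid.ofList u : cs.deletionCon.Quotient) := by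
    intro u
    induction u with
    | nil => simp
    | cons i u ih => rw [wordProd_cons, map_mul, ih, lift_apply_simple]; rfl
  have := (hl u).symm.trans ((congrArg _ h).trans (hl v))
  rw [Con.eq] at this
  simpa using this [] [] k

theorem TrivialAfterDeleting.append {cs : CoxeterSystem M W} {k l : ℕ} {u v : List B}
    (hu : cs.TrivialAfterDeleting k u) (hv : cs.TrivialAfterDeleting l v) :
    cs.TrivialAfterDeleting (k + l) (u ++ v) := by
  obtain ⟨u', h1, h2, h3⟩ := hu
  obtain ⟨v', h4, h5, h6⟩ := hv
  refine ⟨u' ++ v', h1.append h4, by rw [wordProd_append, h2, h5, one_mul], ?_⟩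
  simp only [List.length_append]
  omega

/-- Dyer's theorem (one half), for arbitrary words: a product of `k` reflections becomes trivial
after deleting at most `k` letters of any word that represents it. -/
theorem trivialAfterDeleting_of_prod_reflections (l : List W) (hl : ∀ t ∈ l, cs.IsReflection t)
    {u : List B} (hu : cs.wordProd u = l.prod) : cs.TrivialAfterDeleting l.length u := by
  induction l generalizing u with
  | nil => exact ⟨u, List.Sublist.refl u, by simpa using hu, by simp⟩
  | cons t l ih =>
    obtain ⟨ω, hω⟩ := cs.wordProd_surjective t
    obtain ⟨v, hv⟩ := cs.wordProd_surjective l.prod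
    -- The word may be chosen freely, so take a concatenation of words for the reflections, each of
    -- which needs one deletion.
    rw [cs.trivialAfterDeleting_congr (v := ω ++ v)
      (by rw [hu, wordProd_append, hω, hv, List.prod_cons]), List.length_cons, add_comm]
    refine TrivialAfterDeleting.append (cs.trivialAfterDeleting_one_of_isReflection ?_)
      (ih (fun t ht => hl t (by simp [ht])) hv)
    rw [hω]
    exact hl t (by simp)

theorem trivialAfterDeleting_reflectionLength (u : List B) :
    cs.TrivialAfterDeleting (cs.reflectionLength (cs.wordProd u)) u := by
  obtain ⟨l, hlen, hl, e⟩ := cs.exists_reflection_factorisation (cs.wordProd u)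
  rw [← hlen]
  exact cs.trivialAfterDeleting_of_prod_reflections l hl e.symm

end CoxeterSystem

namespace CoxeterMatrix

variable {B : Type*} (M : CoxeterMatrix B)

/-! ### The geometric representation -/

/-- Twice the standard bilinear form, with the first argument a simple root. -/
noncomputable def simpleCoroot (i : B) : Module.Dual ℝ (B →₀ ℝ) :=
  Finsupp.linearCombination ℝ fun j => -2 * Real.cos (Real.pi / M i j)

/-- The label `∞` needs no separate case: the entry `0` gives `π / 0 = 0` and the value `-2`. On the
diagonal the entry `1` gives `2`. -/
theorem simpleCoroot_single (i j : B) :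
    M.simpleCoroot i (Finsupp.single j 1) = -2 * Real.cos (Real.pi / M i j) := by
  simp [simpleCoroot]

theorem simpleCoroot_self (i : B) : M.simpleCoroot i (Finsupp.single i 1) = 2 := by
  simp [simpleCoroot_single]

theorem simpleCoroot_mul_sub_two (i j : B) :
    M.simpleCoroot i (Finsupp.single j 1) * M.simpleCoroot j (Finsupp.single i 1) - 2 =
      2 * Real.cos (2 * (Real.pi / M i j)) := by
  rw [simpleCoroot_single, simpleCoroot_single, M.symmetric j i, Real.cos_two_mul]
  ring

/-- The reflection of the geometric representation that belongs to a simple reflection. -/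
noncomputable def geometricReflection (i : B) : (B →₀ ℝ) ≃ₗ[ℝ] (B →₀ ℝ) :=
  Module.reflection (M.simpleCoroot_self i)

-- Powers of a product of two reflections have Chebyshev coefficients, and `S_{k-1}(2 cos 2θ) sin 2θ
-- = sin 2kθ`. With `θ = π / m`, the common factor is `S_{k-1} = 0` for `m = 2k`, and `S_k + S_{k-1}
-- = 0` for `m = 2k + 1`.
open Polynomial.Chebyshev in
theorem isLiftable_geometricReflection : M.IsLiftable M.geometricReflection := by
  intro i j
  rcases eq_or_ne i j with rfl | hij
  · rw [M.diagonal, pow_one]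
    ext1 v
    exact Module.involutive_reflection (M.simpleCoroot_self i) v
  rcases Nat.eq_zero_or_pos (M i j) with h0 | hpos
  · rw [h0, pow_zero]
  have hne := M.off_diagonal i j hij
  have hm : (M i j : ℝ) ≠ 0 := by exact_mod_cast hpos.ne'
  have ht := M.simpleCoroot_mul_sub_two i j
  refine LinearEquiv.ext fun v => ?_
  rw [geometricReflection, geometricReflection, Module.reflection_mul_reflection_pow_apply _ _ _ _ _
    ht.symm]
  set θ := Real.pi / M i j with hθ
  have hmθ : M i j * θ = Real.pi := by rw [hθ]; field_simp
  have hS := fun n : ℤ => Polynomial.Chebyshev.S_two_mul_real_cos (2 * θ) n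
  obtain h2 | h3 : M i j = 2 ∨ 3 ≤ M i j := by omega
  -- For label 2 one has `sin 2θ = 0`, so the Chebyshev identity cannot be divided by it.
  · have hc : Real.cos θ = 0 := by
      rw [hθ, h2]; simp
    simp only [simpleCoroot_single, M.symmetric j i, Real.cos_two_mul, h2, hc]
    norm_num
    module
  have hsin : Real.sin (2 * θ) ≠ 0 := by
    apply (Real.sin_pos_of_pos_of_lt_pi (by positivity) _).ne'
    rw [← hmθ]
    have : (3 : ℝ) ≤ M i j := by exact_mod_cast h3
    have : 0 < θ := by positivity
    nlinarith
  obtain ⟨k, hk | hk⟩ := Nat.even_or_odd' (M i j)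
  · have e1 : ((M i j : ℕ) - 2 : ℤ) / 2 = k - 1 := by omega
    have e2 : ((M i j : ℕ) - 1 : ℤ) / 2 = k - 1 := by omega
    have h1 : (S ℝ ((k : ℤ) - 1)).eval (2 * Real.cos (2 * θ)) = 0 := by
      have := hS (k - 1)
      have e : (((k : ℤ) - 1 : ℤ) + 1 : ℝ) * (2 * θ) = Real.pi := by
        rw [← hmθ, hk]; push_cast; ring
      rw [e, Real.sin_pi] at this
      exact (mul_eq_zero.1 this).resolve_right hsin
    rw [e1, e2, h1]
    simp
  · have e1 : ((M i j : ℕ) - 1 : ℤ) / 2 = k := by omega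
    have e2 : ((M i j : ℕ) - 2 : ℤ) / 2 = k - 1 := by omega
    have e3 : ((M i j : ℕ) - 3 : ℤ) / 2 = k - 1 := by omega
    have e4 : ((M i j : ℕ) : ℤ) / 2 = k := by omega
    have h1 : (S ℝ (k : ℤ)).eval (2 * Real.cos (2 * θ)) +
        (S ℝ ((k : ℤ) - 1)).eval (2 * Real.cos (2 * θ)) = 0 := by
      have h1 := hS k
      have h2 := hS (k - 1)
      have e : (((k : ℤ) - 1 : ℤ) + 1 : ℝ) * (2 * θ) = Real.pi - θ := by
        rw [← hmθ, hk]; push_cast; ring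
      have e' : (((k : ℤ) : ℝ) + 1) * (2 * θ) = θ + Real.pi := by
        rw [← hmθ, hk]; push_cast; ring
      rw [e, Real.sin_pi_sub] at h2
      rw [e', Real.sin_add_pi] at h1
      have : ((S ℝ (k : ℤ)).eval (2 * Real.cos (2 * θ)) +
        (S ℝ ((k : ℤ) - 1)).eval (2 * Real.cos (2 * θ))) * Real.sin (2 * θ) = 0 := by
        rw [add_mul, h1, h2]; ring
      exact (mul_eq_zero.1 this).resolve_right hsin
    rw [e1, e2, e3, e4, h1]
    simp

-- Evaluated at the simple root of `i`, a trivial `q`-th power would force `cos 2qθ = 1` although `0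
-- < 2qθ < 2π`; for the label `∞` the second coordinate grows linearly in `q`.
open Polynomial.Chebyshev in
theorem geometricReflection_mul_pow_ne_one {i j : B} (hij : i ≠ j) {q : ℕ} (hq : 0 < q)
    (hqm : M i j = 0 ∨ q < M i j) :
    (M.geometricReflection i * M.geometricReflection j) ^ q ≠ 1 := by
  intro h
  have ht := M.simpleCoroot_mul_sub_two i j
  have h1 := Module.reflection_mul_reflection_pow_apply_self (M.simpleCoroot_self i)
    (M.simpleCoroot_self j) q _ ht.symm
  change ((M.geometricReflection i * M.geometricReflection j) ^ q) _ = _ at h1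
  rw [h] at h1
  have hx := DFunLike.congr_fun h1 i
  have hy := DFunLike.congr_fun h1 j
  simp only [LinearEquiv.coe_one, id_eq, Finsupp.single_eq_same, Finsupp.coe_add,
    Finsupp.coe_smul, Pi.add_apply, Pi.smul_apply, smul_eq_mul, mul_one, ne_eq, hij, hij.symm,
    not_false_eq_true, Finsupp.single_eq_of_ne, mul_zero, add_zero, zero_add, simpleCoroot_single,
    M.symmetric j i] at hx hy
  have hne := M.off_diagonal i j hij
  obtain h0 | h2 | h3 : M i j = 0 ∨ M i j = 2 ∨ 3 ≤ M i j := by omega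
  · simp only [h0, Nat.cast_zero, div_zero, mul_zero, Real.cos_zero, mul_one, S_eval_two] at hy
    push_cast at hy
    have : (0 : ℝ) < q := by exact_mod_cast hq
    nlinarith
  -- Here `cos θ = 0` and the second coordinate says nothing, but the first one is `-1` instead of
  -- `1`.
  · obtain rfl : q = 1 := by omega
    have : 2 * (Real.pi / ((2 : ℕ) : ℝ)) = Real.pi := by push_cast; ring
    simp only [h2, this, Real.cos_pi] at hx
    norm_num at hx
  · have hqm' : q < M i j := by omega
    have hm : (M i j : ℝ) ≠ 0 := by positivity
    have h3' : (3 : ℝ) ≤ M i j := by exact_mod_cast h3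
    have hq' : (q : ℝ) < M i j := by exact_mod_cast hqm'
    have hq0 : (0 : ℝ) < q := by exact_mod_cast hq
    set θ := Real.pi / M i j with hθ
    have hmθ : M i j * θ = Real.pi := by rw [hθ]; field_simp
    have hθ0 : 0 < θ := by positivity
    have hcos : 0 < Real.cos θ := Real.cos_pos_of_mem_Ioo ⟨by linarith [Real.pi_pos], by nlinarith⟩
    have hsin : 0 < Real.sin (2 * θ) :=
      Real.sin_pos_of_pos_of_lt_pi (by positivity) (by nlinarith)
    have hS := fun n : ℤ => Polynomial.Chebyshev.S_two_mul_real_cos (2 * θ) n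
    have hS1 : (S ℝ ((q : ℤ) - 1)).eval (2 * Real.cos (2 * θ)) = 0 := by
      have h0 : (S ℝ ((q : ℤ) - 1)).eval (2 * Real.cos (2 * θ)) * (2 * Real.cos θ) = 0 := by
        linarith
      exact (mul_eq_zero.1 h0).resolve_right (by positivity)
    rw [hS1, add_zero] at hx
    have e1 := hS (q - 1)
    have e2 := hS q
    rw [hS1, zero_mul] at e1
    rw [← hx, one_mul] at e2
    push_cast at e1 e2
    rw [sub_add_cancel] at e1
    rw [add_mul, one_mul, Real.sin_add, ← e1, zero_mul, zero_add] at e2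
    have hcosq : Real.cos (q * (2 * θ)) = 1 := by
      have : (Real.cos (q * (2 * θ)) - 1) * Real.sin (2 * θ) = 0 := by linarith
      linarith [(mul_eq_zero.1 this).resolve_right hsin.ne']
    have hlt : q * (2 * θ) < 2 * Real.pi := by nlinarith
    have := (Real.cos_eq_one_iff_of_lt_of_lt (by nlinarith [Real.pi_pos]) hlt).1 hcosq
    nlinarith

end CoxeterMatrix

namespace CoxeterSystem

variable {B W : Type*} [Group W] {M : CoxeterMatrix B} (cs : CoxeterSystem M W)

theorem simple_mul_simple_pow_ne_one {i j : B} (hij : i ≠ j) {q : ℕ} (hq : 0 < q)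
    (hqm : M i j = 0 ∨ q < M i j) : (cs.simple i * cs.simple j) ^ q ≠ 1 := by
  intro h
  apply M.geometricReflection_mul_pow_ne_one hij hq hqm
  have := congrArg (cs.lift ⟨_, M.isLiftable_geometricReflection⟩) h
  simpa [lift_apply_simple] using this

theorem simple_mul_simple_pow_injOn {i j : B} (hij : i ≠ j) {p q k : ℕ} (hp : p < k) (hq : q < k)
    (hk : M i j = 0 ∨ k ≤ M i j)
    (h : (cs.simple i * cs.simple j) ^ p = (cs.simple i * cs.simple j) ^ q) : p = q := by
  wlog hpq : p ≤ q generalizing p q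
  · exact (this hq hp h.symm (le_of_not_ge hpq)).symm
  by_contra hne
  obtain ⟨d, rfl⟩ := Nat.exists_eq_add_of_le hpq
  rw [pow_add, left_eq_mul] at h
  exact cs.simple_mul_simple_pow_ne_one hij (by omega) (by omega) h

/-! ### Alternating words and pairs of descents -/

/-- The word of length `k` that alternates between `i` and `j`, starting with `i`. -/
def altWord (i j : B) : ℕ → List B
  | 0 => []
  | k + 1 => i :: altWord j i k

@[simp]
theorem length_altWord (i j : B) (k : ℕ) : (altWord i j k).length = k := by
  induction k generalizing i j with
  | zero => rfl
  | succ k ih => simp [altWord, ih]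

theorem leftInvSeq_altWord (i j : B) (k : ℕ) :
    cs.leftInvSeq (altWord i j k) =
      (List.range k).map fun p => (cs.simple i * cs.simple j) ^ p * cs.simple i := by
  induction k generalizing i j with
  | zero => rfl
  | succ k ih =>
    rw [altWord, leftInvSeq, ih, List.range_succ_eq_map, List.map_cons, List.map_map, List.map_map]
    simp only [pow_zero, one_mul, List.cons.injEq, true_and]
    refine List.map_congr_left fun p _ => ?_
    simp only [Function.comp_apply, MulAut.conj_apply, inv_simple, Nat.succ_eq_add_one]
    have : cs.simple i * (cs.simple j * cs.simple i) ^ p * (cs.simple i)⁻¹ =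
        (cs.simple i * (cs.simple j * cs.simple i) * (cs.simple i)⁻¹) ^ p := conj_pow.symm
    rw [inv_simple, ← mul_assoc (cs.simple i) (cs.simple j), simple_mul_simple_cancel_right] at this
    rw [pow_succ, ← this]
    simp [mul_assoc]

/-- The inversions are the `(s_i s_j) ^ p s_i` with `p < k`, distinct because `s_i s_j` has order
exactly `M i j`. -/
theorem isReduced_altWord {i j : B} (hij : i ≠ j) {k : ℕ} (hk : M i j = 0 ∨ k ≤ M i j) :
    cs.IsReduced (altWord i j k) := by
  apply cs.isReduced_of_nodup_leftInvSeq
  rw [leftInvSeq_altWord]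
  refine List.Nodup.map_on (fun p hp q hq h => ?_) List.nodup_range
  rw [List.mem_range] at hp hq
  exact cs.simple_mul_simple_pow_injOn hij hp hq hk (mul_right_cancel h)

/-- If `i` and `j` are distinct left descents of `w`, then `w` has reduced words starting with the
alternating words in `i` and `j` of any length up to `M i j`. -/
theorem exists_isReduced_altWord_append {i j : B} (hij : i ≠ j) {w : W}
    (hi : cs.IsLeftDescent w i) (hj : cs.IsLeftDescent w j) {k : ℕ} (hk : M i j = 0 ∨ k ≤ M i j) :
    ∃ v, cs.IsReduced (altWord i j k ++ v) ∧ cs.wordProd (altWord i j k ++ v) = w := by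
  induction k generalizing i j with
  | zero =>
    obtain ⟨v, hv, e⟩ := cs.exists_isReduced w
    exact ⟨v, hv, e.symm⟩
  | succ k ih =>
    obtain ⟨v, hv, rfl⟩ := ih hij.symm hj hi (by rw [M.symmetric]; omega)
    obtain ⟨p, hp, e⟩ := cs.exists_eraseIdx_of_isLeftDescent hi
    have hprod : cs.wordProd (altWord j i k ++ v) =
        cs.wordProd (i :: (altWord j i k ++ v).eraseIdx p) := by
      rw [wordProd_cons, e, simple_mul_simple_cancel_left]
    -- The exchange puts `i` in front and deletes one letter. If that letter lay in the alternating
    -- prefix, the reduced alternating word of length `k + 1` would have an expression with only `k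
    -- - 1` letters.
    rcases lt_or_ge p k with hpk | hpk
    · exfalso
      rw [List.eraseIdx_append_of_lt_length (by simpa using hpk), wordProd_append,
        wordProd_append, ← mul_assoc, mul_left_inj, ← wordProd_cons] at e
      have h1 := cs.isReduced_altWord hij hk
      have h2 := cs.length_wordProd_le ((altWord j i k).eraseIdx p)
      have h3 := List.length_eraseIdx_add_one (l := altWord j i k) (i := p) (by simpa using hpk)
      rw [altWord, IsReduced, ← e] at h1
      simp only [List.length_cons, length_altWord] at h1 h3
      omega
    · rw [List.eraseIdx_append_of_length_le (by simpa using hpk)] at hprod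
      refine ⟨v.eraseIdx (p - (altWord j i k).length), ?_, hprod.symm⟩
      rw [altWord, List.cons_append, IsReduced, ← hprod, hv.eq]
      simp only [List.length_append, length_altWord, List.length_cons] at hp ⊢
      have := List.length_eraseIdx_add_one (l := v) (i := p - k) (by omega)
      omega

end CoxeterSystem

/-! ### Weak descents of words -/

namespace List

theorem exists_eq_append_cons_cons_self {α : Type*} {l : List α} (h : ¬ l.IsChain (· ≠ ·)) :
    ∃ x c y, l = x ++ c :: c :: y := by
  induction l with
  | nil => simp at h
  | cons a l ih =>
    cases l with
    | nil => simp at h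
    | cons b l =>
      by_cases hab : a = b
      · exact ⟨[], a, l, by rw [hab, nil_append]⟩
      · rw [isChain_cons_cons] at h
        obtain ⟨x, c, y, e⟩ := ih fun h' => h ⟨hab, h'⟩
        exact ⟨a :: x, c, y, by rw [e, cons_append]⟩

variable {α : Type*} [LinearOrder α]

/-- The number of weak descents of a word, that is, of positions where the next letter is at most
the current one. -/
def weakDescents : List α → ℕ
  | [] => 0
  | [_] => 0
  | a :: b :: l => (if b ≤ a then 1 else 0) + weakDescents (b :: l)

theorem weakDescents_cons_cons (a b : α) (l : List α) :
    weakDescents (a :: b :: l) = (if b ≤ a then 1 else 0) + weakDescents (b :: l) := rfl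

theorem weakDescents_le_cons (a : α) (l : List α) : l.weakDescents ≤ (a :: l).weakDescents := by
  cases l with
  | nil => rfl
  | cons b l => rw [weakDescents_cons_cons]; omega

/-- If `c ≤ a`, then any `b` between them satisfies `b ≤ a` or `c ≤ b`, so deleting `b` creates no
new weak descent. -/
theorem weakDescents_cons_le_cons_cons (a b : α) (l : List α) :
    weakDescents (a :: l) ≤ weakDescents (a :: b :: l) := by
  cases l with
  | nil => exact Nat.zero_le _
  | cons c l =>
    simp only [weakDescents_cons_cons]
    split_ifs with h1 h2 h3 h3 <;> try omega
    exact absurd (h1.trans (not_le.1 h2).le) h3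

theorem Sublist.weakDescents_cons_le {l l' : List α} (h : l.Sublist l') (a : α) :
    (a :: l).weakDescents ≤ (a :: l').weakDescents := by
  induction h generalizing a with
  | slnil => exact le_rfl
  | cons b _ ih => exact (ih a).trans (weakDescents_cons_le_cons_cons a b _)
  | cons_cons b _ ih =>
    rw [weakDescents_cons_cons, weakDescents_cons_cons]
    exact Nat.add_le_add_left (ih b) _

theorem Sublist.weakDescents_le {l l' : List α} (h : l.Sublist l') :
    l.weakDescents ≤ l'.weakDescents := by
  induction h with
  | slnil => exact le_rfl
  | cons b _ ih => exact ih.trans (weakDescents_le_cons b _)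
  | cons_cons b h _ => exact h.weakDescents_cons_le b

theorem weakDescents_append_le (l l' : List α) :
    (l ++ l').weakDescents ≤ l.weakDescents + l'.weakDescents + 1 := by
  induction l with
  | nil => rw [nil_append]; omega
  | cons a l ih =>
    cases l with
    | nil =>
      cases l' with
      | nil => exact Nat.zero_le _
      | cons b l' =>
        rw [singleton_append, weakDescents_cons_cons]
        split_ifs <;> omega
    | cons b l =>
      rw [cons_append, cons_append, weakDescents_cons_cons, weakDescents_cons_cons]
      rw [cons_append] at ih
      omega

theorem weakDescents_eq_zero_of_pairwise_lt {l : List α} (h : l.Pairwise (· < ·)) :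
    l.weakDescents = 0 := by
  induction l with
  | nil => rfl
  | cons a l ih =>
    cases l with
    | nil => rfl
    | cons b l =>
      rw [weakDescents_cons_cons, ih h.of_cons, if_neg]
      exact not_le.2 (rel_of_pairwise_cons h (by simp))

/-- Weak rather than strict descents are counted precisely so that an equal adjacent pair
contributes one, which is lost when the pair is cancelled. -/
theorem weakDescents_append_cons_cons_self (x y : List α) (c : α) :
    (x ++ y).weakDescents + 1 ≤ (x ++ c :: c :: y).weakDescents := by
  induction x with
  | nil =>
    have := weakDescents_le_cons c y
    rw [nil_append, nil_append, weakDescents_cons_cons, if_pos le_rfl]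
    omega
  | cons a x ih =>
    cases x with
    | nil =>
      cases y with
      | nil =>
        simp only [cons_append, nil_append, weakDescents_cons_cons, le_refl, if_true]
        simp only [weakDescents]
        omega
      | cons b y =>
        simp only [cons_append, nil_append, weakDescents_cons_cons, le_refl, if_true]
        split_ifs with h1 h2 h3 h3 h3 <;> try omega
        exact absurd (h1.trans (not_le.1 h2).le) h3
    | cons b x =>
      simp only [cons_append, weakDescents_cons_cons] at ih ⊢
      omega

/-- The cut is made at the weak descent number `h`, counted from 0, which is then lost to both
parts. -/
theorem exists_split_of_lt_weakDescents {u : List α} {h : ℕ} (hu : h < u.weakDescents) :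
    ∃ x y, u = x ++ y ∧ x ≠ [] ∧ y ≠ [] ∧ x.weakDescents = h ∧
      h + y.weakDescents + 1 = u.weakDescents := by
  induction u generalizing h with
  | nil => simp [weakDescents] at hu
  | cons a u ih =>
    cases u with
    | nil => simp [weakDescents] at hu
    | cons b l =>
      have key : ∀ h', h' < (b :: l).weakDescents → (if b ≤ a then 1 else 0) + h' = h →
          ∃ x y, a :: b :: l = x ++ y ∧ x ≠ [] ∧ y ≠ [] ∧ x.weakDescents = h ∧
            h + y.weakDescents + 1 = (a :: b :: l).weakDescents := by
        intro h' hlt hh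
        obtain ⟨x, y, e, hx, hy, h1, h2⟩ := ih hlt
        cases x with
        | nil => exact absurd rfl hx
        | cons c x =>
          obtain ⟨rfl, rfl⟩ := cons.inj e
          refine ⟨a :: b :: x, y, rfl, by simp, hy, ?_, ?_⟩ <;>
          · rw [weakDescents_cons_cons]
            omega
      rw [weakDescents_cons_cons] at hu
      split_ifs at hu key with hba
      · cases h with
        | zero =>
          refine ⟨[a], b :: l, rfl, by simp, by simp, rfl, ?_⟩
          rw [weakDescents_cons_cons, if_pos hba]
          omega
        | succ h => exact key h (by omega) (by omega)
      · exact key h (by omega) (by omega)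

end List

/-! ### Words with few weak descents: reducedness, uniqueness and nontriviality -/

namespace CoxeterSystem

variable {B W : Type*} [Group W] {M : CoxeterMatrix B} (cs : CoxeterSystem M W)

theorem exists_isReduced_cons_of_isLeftDescent {w : W} {i : B} (h : cs.IsLeftDescent w i) :
    ∃ v, cs.IsReduced (i :: v) ∧ cs.wordProd (i :: v) = w := by
  obtain ⟨v, hv, e⟩ := cs.exists_isReduced (cs.simple i * w)
  have hw : cs.wordProd (i :: v) = w := by
    rw [wordProd_cons, ← e, simple_mul_simple_cancel_left]
  refine ⟨v, ?_, hw⟩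
  rw [IsReduced, hw, List.length_cons, ← hv.eq, ← e]
  exact (cs.isLeftDescent_iff.1 h).symm

theorem isLeftDescent_of_isReduced_cons {i : B} {v : List B} (h : cs.IsReduced (i :: v)) :
    cs.IsLeftDescent (cs.wordProd (i :: v)) i := by
  rw [IsLeftDescent, h.eq, wordProd_cons, simple_mul_simple_cancel_left]
  exact Nat.lt_succ_of_le (cs.length_wordProd_le v)

theorem isReduced_cons_of_not_isLeftDescent {i : B} {v : List B} (hv : cs.IsReduced v)
    (h : ¬ cs.IsLeftDescent (cs.wordProd v) i) : cs.IsReduced (i :: v) := by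
  rw [IsReduced, wordProd_cons, cs.not_isLeftDescent_iff.1 h, hv.eq, List.length_cons]

variable [LinearOrder B]

/-- Every second step goes down; starting with the larger letter, the first step already does. -/
theorem le_weakDescents_altWord (i j : B) (k : ℕ) :
    (i < j → (k - 1) / 2 ≤ (altWord i j k).weakDescents) ∧
      (j < i → k / 2 ≤ (altWord i j k).weakDescents) := by
  induction k generalizing i j with
  | zero => simp
  | succ k ih =>
    cases k with
    | zero => simp
    | succ k =>
      have := ih j i
      rw [altWord] at this
      rw [altWord, altWord, List.weakDescents_cons_cons]
      constructor
      · intro h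
        have := this.2 h
        omega
      · intro h
        have := this.1 h
        rw [if_pos h.le]
        omega

/-- If all labels are large compared to the number of weak descents of a word without repeated
adjacent letters, then the word is the only reduced word of the element that it represents. -/
theorem isReduced_and_unique {z : List B} (hz : z.IsChain (· ≠ ·))
    (hM : ∀ i j, i ≠ j → M i j = 0 ∨ 2 * z.weakDescents + 3 ≤ M i j) :
    cs.IsReduced z ∧ ∀ z', cs.IsReduced z' → cs.wordProd z' = cs.wordProd z → z' = z := by
  induction z with
  | nil =>
    refine ⟨by simp [IsReduced], fun z' h e => ?_⟩
    rw [IsReduced, e, wordProd_nil, length_one] at h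
    exact List.length_eq_zero_iff.1 h.symm
  | cons a z ih =>
    have hle := List.weakDescents_le_cons a z
    obtain ⟨hred, huniq⟩ := ih hz.tail fun i j hij => (hM i j hij).imp id fun h => by omega
    have hnd : ¬ cs.IsLeftDescent (cs.wordProd z) a := by
      intro hd
      obtain ⟨v, hv, e⟩ := cs.exists_isReduced_cons_of_isLeftDescent hd
      rw [← huniq _ hv e, List.isChain_cons_cons] at hz
      exact hz.1 rfl
    have hared := cs.isReduced_cons_of_not_isLeftDescent hred hnd
    refine ⟨hared, fun z' hz' e => ?_⟩
    cases z' with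
    | nil =>
      rw [IsReduced, ← e] at hared
      simp at hared
    | cons b v =>
      by_cases hab : a = b
      · subst hab
        rw [wordProd_cons, wordProd_cons, mul_right_inj] at e
        rw [huniq v (hz'.drop 1) e]
      · exfalso
        have hb := cs.isLeftDescent_of_isReduced_cons hz'
        rw [e] at hb
        -- Two distinct descents force an alternating prefix of length `2d + 3`, where `d` is the
        -- number of weak descents. By uniqueness for the tail it is a prefix of the word itself,
        -- yet it has at least `d + 1` weak descents whichever letter comes first.
        obtain ⟨v', hv', e'⟩ := cs.exists_isReduced_altWord_append hab
          (cs.isLeftDescent_of_isReduced_cons hared) hb (hM a b hab)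
        rw [altWord, List.cons_append] at hv' e'
        rw [wordProd_cons, wordProd_cons, mul_right_inj] at e'
        have h1 := huniq _ (hv'.drop 1) e'
        have h2 : (altWord a b (2 * (a :: z).weakDescents + 3)).weakDescents ≤
            (a :: z).weakDescents := by
          conv_rhs => rw [← h1]
          exact (List.sublist_append_left _ v').weakDescents_le
        have h3 := le_weakDescents_altWord a b (2 * (a :: z).weakDescents + 3)
        rcases lt_or_gt_of_ne hab with h | h
        · have := h3.1 h
          omega
        · have := h3.2 h
          omega

/-- With labels one smaller, uniqueness may fail, but an alternating prefix of length `2d + 2` still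
has `d + 1` weak descents if it starts with the larger letter. This excludes left descents below the
first letter, and that suffices to carry reducedness through the induction. -/
theorem isReduced_and_head_le {z : List B} (hz : z.IsChain (· ≠ ·))
    (hM : ∀ i j, i ≠ j → M i j = 0 ∨ 2 * z.weakDescents + 2 ≤ M i j) :
    cs.IsReduced z ∧ ∀ s, cs.IsLeftDescent (cs.wordProd z) s → ∃ a v, z = a :: v ∧ a ≤ s := by
  induction z with
  | nil =>
    refine ⟨by simp [IsReduced], fun s h => ?_⟩
    exact absurd h (cs.not_isLeftDescent_one s)
  | cons a z ih =>
    have hle := List.weakDescents_le_cons a z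
    obtain ⟨hred, hhead⟩ := ih hz.tail fun i j hij => (hM i j hij).imp id fun h => by omega
    -- If the tail starts with a letter at most `a`, the seam is a weak descent; the tail has one
    -- fewer, and `2(d - 1) + 3 ≤ 2d + 2`, so `isReduced_and_unique` applies to it.
    have huniq : ∀ b v, z = b :: v → b ≤ a →
        ∀ z', cs.IsReduced z' → cs.wordProd z' = cs.wordProd z → z' = z := by
      rintro b v rfl hba
      refine (cs.isReduced_and_unique (z := b :: v) hz.tail fun i j hij => (hM i j hij).imp id fun h => ?_).2
      rw [List.weakDescents_cons_cons, if_pos hba] at h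
      omega
    have hnd : ¬ cs.IsLeftDescent (cs.wordProd z) a := by
      intro hd
      obtain ⟨b, v, rfl, hba⟩ := hhead a hd
      obtain ⟨v', hv', e⟩ := cs.exists_isReduced_cons_of_isLeftDescent hd
      have := huniq b v rfl hba _ hv' e
      rw [List.isChain_cons_cons] at hz
      exact hz.1 (List.cons.inj this).1
    have hared := cs.isReduced_cons_of_not_isLeftDescent hred hnd
    refine ⟨hared, fun s hs => ⟨a, z, rfl, ?_⟩⟩
    by_contra! hsa
    obtain ⟨v', hv', e'⟩ := cs.exists_isReduced_altWord_append hsa.ne'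
      (cs.isLeftDescent_of_isReduced_cons hared) hs (hM a s hsa.ne')
    rw [altWord, List.cons_append] at hv' e'
    rw [wordProd_cons, wordProd_cons, mul_right_inj] at e'
    have hv := hv'.drop 1
    rw [List.drop_one, List.tail_cons] at hv
    -- After removing `a`, the alternating word starts with `s`. So the head of the tail is at most
    -- `s < a`, and the tail is a unique reduced word.
    have hds : cs.IsLeftDescent (cs.wordProd z) s := by
      rw [← e']
      rw [altWord, List.cons_append] at hv ⊢
      exact cs.isLeftDescent_of_isReduced_cons hv
    obtain ⟨b, v, hzb, hbs⟩ := hhead s hds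
    have h1 := huniq b v hzb (hbs.trans hsa.le) _ hv e'
    have h2 : (altWord a s (2 * (a :: z).weakDescents + 2)).weakDescents ≤
        (a :: z).weakDescents := by
      conv_rhs => rw [← h1]
      exact (List.sublist_append_left _ v').weakDescents_le
    have h3 := (le_weakDescents_altWord a s (2 * (a :: z).weakDescents + 2)).2 hsa
    omega

theorem wordProd_ne_one_of_isChain {u : List B} (hu : u.IsChain (· ≠ ·)) (hne : u ≠ [])
    (hM : ∀ i j, i ≠ j → M i j = 0 ∨ u.weakDescents + 2 ≤ M i j) : cs.wordProd u ≠ 1 := by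
  intro h
  rcases Nat.eq_zero_or_pos u.weakDescents with h0 | hpos
  · have := (cs.isReduced_and_head_le hu (by simpa [h0] using hM)).1
    rw [IsReduced, h, length_one, eq_comm, List.length_eq_zero_iff] at this
    exact hne this
  -- With `d` weak descents in all, the parts get `⌊d/2⌋` and `⌈d/2⌉ - 1`. The label bound `d + 2`
  -- then covers `2⌊d/2⌋ + 2` for reducedness of `x` and `2⌈d/2⌉ + 1` for uniqueness of `y`.
  · obtain ⟨x, y, rfl, hx, hy, h1, h2⟩ :=
      List.exists_split_of_lt_weakDescents (show u.weakDescents / 2 < u.weakDescents by omega)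
    have hxr := (cs.isReduced_and_head_le (List.isChain_append.1 hu).1
      fun i j hij => (hM i j hij).imp id fun h => by omega).1
    have hyu := (cs.isReduced_and_unique (List.isChain_append.1 hu).2.1
      fun i j hij => (hM i j hij).imp id fun h => by omega).2
    rw [wordProd_append] at h
    -- If the product is trivial, the reverse of `x` is a reduced word for the element of `y`, hence
    -- equals `y`, and two equal letters meet at the cut.
    have := hyu x.reverse hxr.reverse (by
      rw [wordProd_reverse]; exact (eq_inv_of_mul_eq_one_right h).symm)
    subst this
    rcases List.eq_nil_or_concat' x with rfl | ⟨x, c, rfl⟩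
    · exact hx rfl
    · have := (List.isChain_append.1 hu).2.2 c (by simp) c (by simp)
      exact this rfl

/-- A word that represents the identity has at most twice as many letters as weak descents, if
the labels are large compared to the number of weak descents. -/
theorem length_le_two_mul_weakDescents {u : List B} (hu : cs.wordProd u = 1)
    (hM : ∀ i j, i ≠ j → M i j = 0 ∨ u.weakDescents + 2 ≤ M i j) :
    u.length ≤ 2 * u.weakDescents := by
  induction h : u.length using Nat.strong_induction_on generalizing u with
  | _ N ih =>
  subst h
  by_cases hc : u.IsChain (· ≠ ·)
  · have : u = [] := by
      by_contra hne
      exact cs.wordProd_ne_one_of_isChain hc hne hM hu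
    simp [this]
  · obtain ⟨x, c, y, rfl⟩ := List.exists_eq_append_cons_cons_self hc
    -- Cancelling the pair costs two letters and at least one weak descent, which preserves the
    -- ratio 2 and the label bound.
    have hd := List.weakDescents_append_cons_cons_self x y c
    have := ih (x ++ y).length (by simp) (by simpa [wordProd_append, wordProd_cons] using hu)
      (fun i j hij => (hM i j hij).imp id fun h => by omega) rfl
    simp only [List.length_append, List.length_cons] at this ⊢
    omega

/-- What remains after the deletions is trivial and has no more weak descents than `u`, hence at
most twice that many letters. -/
theorem length_le_reflectionLength_add (u : List B)
    (hM : ∀ i j, i ≠ j → M i j = 0 ∨ u.weakDescents + 2 ≤ M i j) :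
    u.length ≤ cs.reflectionLength (cs.wordProd u) + 2 * u.weakDescents := by
  obtain ⟨v, hv, hv1, hlen⟩ := cs.trivialAfterDeleting_reflectionLength u
  have hle := hv.weakDescents_le
  have := cs.length_le_two_mul_weakDescents hv1
    fun i j hij => (hM i j hij).imp id fun h => by omega
  omega

end CoxeterSystem

/-! ### Periodic words -/

namespace List

theorem append_flatten_replicate_cons {α : Type*} (a : α) (T : List α) (k : ℕ) :
    T ++ (replicate k (a :: T)).flatten = (replicate k (T ++ [a])).flatten ++ T := by
  induction k with
  | zero => simp
  | succ k ih =>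
    rw [replicate_succ, flatten_cons, replicate_succ, flatten_cons, append_assoc, ← ih]
    simp

theorem length_flatten_replicate {α : Type*} (L : List α) (k : ℕ) :
    (replicate k L).flatten.length = k * L.length := by
  simp

variable {α : Type*} [LinearOrder α]

/-- Weak descents can occur only at the seams and inside `l`; each copy of `L` adds at most one
seam. -/
theorem weakDescents_flatten_replicate_append_le {L : List α} (hL : L.weakDescents = 0) (k : ℕ)
    (l : List α) : ((replicate k L).flatten ++ l).weakDescents ≤ k + l.weakDescents := by
  induction k with
  | zero => simp
  | succ k ih =>
    rw [replicate_succ, flatten_cons, append_assoc]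
    have := weakDescents_append_le L ((replicate k L).flatten ++ l)
    omega

theorem weakDescents_append_flatten_replicate_le {L : List α} (hL : L.weakDescents = 0) (k : ℕ)
    (l : List α) : (l ++ (replicate k L).flatten).weakDescents ≤ l.weakDescents + k := by
  induction k generalizing l with
  | zero => simp
  | succ k ih =>
    rw [replicate_succ, flatten_cons, ← append_assoc]
    have h1 := ih (l ++ L)
    have h2 := weakDescents_append_le l L
    omega

end List

namespace CoxeterSystem

variable {B W : Type*} [Group W] {M : CoxeterMatrix B} (cs : CoxeterSystem M W)

/-! ### Reflection length of powers -/

theorem reflectionLength_prod_le {l : List W} (hl : ∀ t ∈ l, cs.IsReflection t) :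
    cs.reflectionLength l.prod ≤ l.length :=
  Nat.sInf_le ⟨l, rfl, hl, rfl⟩

theorem reflectionLength_mul_le (w w' : W) :
    cs.reflectionLength (w * w') ≤ cs.reflectionLength w + cs.reflectionLength w' := by
  obtain ⟨l, hlen, hl, e⟩ := cs.exists_reflection_factorisation w
  obtain ⟨l', hlen', hl', e'⟩ := cs.exists_reflection_factorisation w'
  rw [← hlen, ← hlen', ← List.length_append]
  conv_lhs => rw [← e, ← e', ← List.prod_append]
  refine cs.reflectionLength_prod_le fun t ht => ?_
  rcases List.mem_append.1 ht with h | h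
  exacts [hl t h, hl' t h]

theorem reflectionLength_wordProd_le (u : List B) :
    cs.reflectionLength (cs.wordProd u) ≤ u.length := by
  rw [← List.length_map (as := u) cs.simple]
  refine cs.reflectionLength_prod_le fun t ht => ?_
  obtain ⟨i, -, rfl⟩ := List.mem_map.1 ht
  exact cs.isReflection_simple i

theorem reflectionLength_conj_le (g w : W) :
    cs.reflectionLength (g * w * g⁻¹) ≤ cs.reflectionLength w := by
  obtain ⟨l, hlen, hl, e⟩ := cs.exists_reflection_factorisation w
  have : (l.map (MulAut.conj g)).prod = g * w * g⁻¹ := by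
    rw [← map_list_prod, e, MulAut.conj_apply]
  rw [← this, ← hlen, ← List.length_map (as := l) (MulAut.conj g)]
  refine cs.reflectionLength_prod_le fun t ht => ?_
  obtain ⟨t', ht', rfl⟩ := List.mem_map.1 ht
  exact (hl t' ht').conj g

theorem reflectionLength_conj (g w : W) :
    cs.reflectionLength (g * w * g⁻¹) = cs.reflectionLength w := by
  refine le_antisymm (cs.reflectionLength_conj_le g w) ?_
  have := cs.reflectionLength_conj_le g⁻¹ (g * w * g⁻¹)
  rwa [show g⁻¹ * (g * w * g⁻¹) * g⁻¹⁻¹ = w by group] at this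

theorem reflectionLength_wordProd_power_succ_append (a : B) (T : List B) (k : ℕ) :
    cs.reflectionLength (cs.wordProd ((List.replicate (k + 1) (a :: T)).flatten ++ [a])) =
      cs.reflectionLength (cs.wordProd (T ++ (List.replicate k (a :: T)).flatten)) := by
  rw [← cs.reflectionLength_conj (cs.simple a), List.replicate_succ, List.flatten_cons,
    List.cons_append, List.cons_append, wordProd_cons, wordProd_append _ _ [a],
    wordProd_singleton, inv_simple, mul_assoc, mul_assoc, mul_assoc, simple_mul_simple_self,
    mul_one, simple_mul_simple_cancel_left]

/-- The induction runs over all words `L`, because conjugation by the first letter `a` replaces `a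
:: T` by its rotation `T ++ [a]`, with prefix `T` of length `L.length - 1`. -/
theorem reflectionLength_power_le (L : List B) (hL : 2 ≤ L.length) (k : ℕ) {r : ℕ} (hr : 1 ≤ r)
    (hrn : r ≤ L.length) :
    cs.reflectionLength (cs.wordProd ((List.replicate k L).flatten ++ L.take r)) ≤
      k * (L.length - 2) + r := by
  induction k generalizing L r with
  | zero =>
    refine (cs.reflectionLength_wordProd_le _).trans ?_
    simp
  | succ k ih =>
    cases L with
    | nil => simp at hL
    | cons a T =>
      obtain ⟨r, rfl⟩ := Nat.exists_eq_add_of_le' hr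
      rw [List.take_succ_cons, List.append_cons, wordProd_append]
      refine (cs.reflectionLength_mul_le _ _).trans ?_
      rw [reflectionLength_wordProd_power_succ_append, List.append_flatten_replicate_cons]
      have h1 := cs.reflectionLength_wordProd_le (T.take r)
      have h2 := ih (T ++ [a]) (by simpa using hL) (r := T.length)
        (by simpa using hL) (by simp)
      rw [List.take_left] at h2
      simp only [List.length_append, List.length_cons, List.length_nil, List.length_take]
        at h1 h2 hL ⊢
      obtain ⟨d, hd⟩ : ∃ d, T.length = d + 1 := ⟨T.length - 1, by omega⟩
      rw [hd] at h1 h2 ⊢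
      simp only [zero_add] at h2 ⊢
      have e : d + 1 + 1 - 2 = d := by omega
      rw [e] at h2 ⊢
      rw [add_one_mul]
      omega

theorem reflectionLength_coxeterPowerWord {n : ℕ} {M : CoxeterMatrix (Fin n)}
    (cs : CoxeterSystem M W) (hn : 2 ≤ n) {lam r : ℕ} (hr : 1 ≤ r) (hrn : r ≤ n)
    (hM : ∀ i j, i ≠ j → M i j = 0 ∨ lam + (if 2 ≤ r then 1 else 0) + 1 ≤ M i j) :
    cs.reflectionLength (cs.wordProd (coxeterPowerWord n lam r)) = lam * (n - 2) + r := by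
  have hlen : (List.finRange n).length = n := List.length_finRange
  have hdesc : (List.finRange n).weakDescents = 0 :=
    List.weakDescents_eq_zero_of_pairwise_lt (List.pairwise_lt_finRange n)
  obtain ⟨d, rfl⟩ := Nat.exists_eq_add_of_le' hn
  rw [Nat.add_sub_cancel]
  refine le_antisymm ?_ ?_
  · have := cs.reflectionLength_power_le (List.finRange (d + 2)) (by omega) lam hr (by omega)
    rwa [hlen] at this
  have hcase : 2 ≤ r ∨ lam = 0 →
      lam * d + r ≤ cs.reflectionLength (cs.wordProd (coxeterPowerWord (d + 2) lam r)) := by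
    intro h
    have h1 := List.weakDescents_flatten_replicate_append_le hdesc lam
      ((List.finRange (d + 2)).take r)
    have h2 := (List.take_sublist r (List.finRange (d + 2))).weakDescents_le
    have h3 := cs.length_le_reflectionLength_add (coxeterPowerWord (d + 2) lam r)
      fun i j hij => by
        -- For `lam = 0` and `r = 1` the hypothesis only makes a nonzero entry at least 1; the
        -- required 2 follows from `M i j ≠ 1`.
        have h4 := M.off_diagonal i j hij
        have h5 := hM i j hij
        rw [coxeterPowerWord]
        rcases h with h | h
        · rw [if_pos h] at h5
          omega
        · omega
    have h4 : (coxeterPowerWord (d + 2) lam r).length = lam * (d + 2) + r := by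
      simp [coxeterPowerWord, hrn]
    have h5 : (coxeterPowerWord (d + 2) lam r).weakDescents ≤ lam := by
      rw [coxeterPowerWord]
      omega
    rw [mul_add] at h4
    omega
  by_cases h : 2 ≤ r ∨ lam = 0
  · exact hcase h
  -- For `r = 1` the labels may be only `lam + 1`, one too few for a word with `lam` weak descents.
  -- Conjugation by the first letter leaves a word with at most `lam - 1`, for which they suffice.
  obtain ⟨k, rfl⟩ : ∃ k, lam = k + 1 := ⟨lam - 1, by omega⟩
  obtain rfl : r = 1 := by omega
  rw [if_neg (by omega)] at hM
  rw [coxeterPowerWord]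
  cases hL : List.finRange (d + 2) with
  | nil => simp [hL] at hlen
  | cons a T =>
    rw [hL] at hdesc hlen
    rw [List.take_succ_cons, List.take_zero, reflectionLength_wordProd_power_succ_append]
    have h1 := List.weakDescents_append_flatten_replicate_le hdesc k T
    have h2 := List.weakDescents_le_cons a T
    have h3 := cs.length_le_reflectionLength_add (T ++ (List.replicate k (a :: T)).flatten)
      fun i j hij => (hM i j hij).imp id fun h => by omega
    have h4 : (T ++ (List.replicate k (a :: T)).flatten).length = d + 1 + k * (d + 2) := by
      rw [List.length_append, List.length_flatten_replicate, hlen]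
      simpa using hlen
    rw [mul_add] at h4
    rw [add_one_mul]
    omega

theorem reflectionLength_one : cs.reflectionLength 1 = 0 := by
  simpa using cs.reflectionLength_wordProd_le []

theorem reflectionLength_simple (i : B) : cs.reflectionLength (cs.simple i) = 1 := by
  refine le_antisymm (by simpa using cs.reflectionLength_wordProd_le [i]) ?_
  obtain ⟨l, hlen, -, e⟩ := cs.exists_reflection_factorisation (cs.simple i)
  rw [← hlen, Nat.one_le_iff_ne_zero]
  intro h
  rw [List.length_eq_zero_iff.1 h, List.prod_nil] at e
  have := cs.length_simple i
  rw [← e, length_one] at this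
  exact zero_ne_one this

/-- This settles `n = 1`, where the formula for `n ≥ 2` is not available: only the parity of the
word matters. -/
theorem reflectionLength_wordProd_of_subsingleton [Subsingleton B] (u : List B) :
    cs.reflectionLength (cs.wordProd u) = u.length % 2 := by
  induction h : u.length using Nat.strong_induction_on generalizing u with
  | _ N ih =>
  subst h
  match u with
  | [] => simp [reflectionLength_one]
  | [i] => simp [reflectionLength_simple]
  | i :: j :: u =>
    obtain rfl := Subsingleton.elim i j
    rw [wordProd_cons, wordProd_cons, simple_mul_simple_cancel_left, ih _ (by simp) u rfl]
    exact (Nat.add_mod_right u.length 2).symm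

end CoxeterSystem

/-! ### Comparison with the universal Coxeter group -/

theorem CoxeterMatrix.eq_zero_or_le_of_lt_minLabel {B : Type*} {M : CoxeterMatrix B} {c : ℕ}
    (h : (c : ℕ∞) < M.minLabel) {i j : B} (hij : i ≠ j) : M i j = 0 ∨ c + 1 ≤ M i j := by
  have hle : M.minLabel ≤ M.label i j := iInf_le_of_le i (iInf_le_of_le j (iInf_le _ hij))
  have hlt := h.trans_le hle
  unfold CoxeterMatrix.label at hlt
  split_ifs at hlt with h0
  · exact Or.inl h0
  · exact Or.inr (by exact_mod_cast hlt)

theorem mainTheorem6 {n : ℕ} {W : Type*} [Group W] (M : CoxeterMatrix (Fin n))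
    (cs : CoxeterSystem M W) (lam r : ℕ) (hr : 1 ≤ r) (hrn : r ≤ n)
    (hlam : ((lam + (if 2 ≤ r then 1 else 0) : ℕ) : ℕ∞) < M.minLabel) :
    cs.reflectionLength (cs.wordProd (coxeterPowerWord n lam r)) =
        (CoxeterMatrix.universal n).toCoxeterSystem.reflectionLength
          ((CoxeterMatrix.universal n).toCoxeterSystem.wordProd (coxeterPowerWord n lam r)) ∧
      (2 ≤ n →
        cs.reflectionLength (cs.wordProd (coxeterPowerWord n lam r)) = lam * (n - 2) + r) := by
  have hval : 2 ≤ n →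
      cs.reflectionLength (cs.wordProd (coxeterPowerWord n lam r)) = lam * (n - 2) + r :=
    fun hn => cs.reflectionLength_coxeterPowerWord hn hr hrn
      fun i j hij => CoxeterMatrix.eq_zero_or_le_of_lt_minLabel hlam hij
  refine ⟨?_, hval⟩
  rcases lt_or_ge n 2 with hn | hn
  · obtain rfl : n = 1 := by omega
    rw [CoxeterSystem.reflectionLength_wordProd_of_subsingleton,
      CoxeterSystem.reflectionLength_wordProd_of_subsingleton]
  · rw [hval hn, CoxeterSystem.reflectionLength_coxeterPowerWord _ hn hr hrn]
    intro i j hij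
    exact Or.inl (if_neg hij)
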